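/- Let $K$ be a field, let $S = K[x_1,\dots,x_n]$ with its standard grading, and for a nonzero homogeneous ideal $J \subseteq S$ let $$\operatorname{reg}(J) = \max\{\, j - i \;:\; i \ge 0,\ \operatorname{Tor}_i^S(J,K)_j \neq 0 \,\}$$ be its Castelnuovo--Mumford regularity (as a module; thus $\operatorname{reg}(S) = 0$). Let $I \subseteq S$ be a monomial ideal, and let $x$ be a variable appearing in $I$, that is, dividing at least one of the minimal monomial generators of $I$. Then the maxima defining $\operatorname{reg}(I)$, $\operatorname{reg}(I : x)$ and $\operatorname{reg}(I,x)$ exist, where $(I,x) = I + (x)$, and $$\operatorname{reg}(I) \le \max\{\operatorname{reg}(I : x) + 1,\ \operatorname{reg}(I, x)\}.$$ Moreover, $\operatorname{reg}(I) = \operatorname{reg}(I : x) + 1$ or $\operatorname{reg}(I) = \operatorname{reg}(I,x)$. -/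

import Mathlib

noncomputable section

open MvPolynomial

/-- A resolution of `K`, viewed as the graded module `S / (x_1, …, x_n)` over the standard graded
polynomial ring `S = K[x_1, …, x_n]`, by finitely generated graded free `S`-modules.
The `i`-th module is `⨁_{b ∈ ι i} S(-deg b)`, and `d i` is the matrix of the differential from the
`(i+1)`-st to the `i`-th module. -/
structure GradedFreeResolution (K : Type*) [Field K] (n : ℕ) where
  ι : ℕ → Type
  [fintype : ∀ i, Fintype (ι i)]
  [decEq : ∀ i, DecidableEq (ι i)]
  deg : ∀ i, ι i → ℕ
  d : ∀ i, Matrix (ι i) (ι (i + 1)) (MvPolynomial (Fin n) K)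
  /-- The augmentation; `S` acts on `K` through the constant coefficient. -/
  aug : (ι 0 → MvPolynomial (Fin n) K) →ₛₗ[(constantCoeff : MvPolynomial (Fin n) K →+* K)] K
  d_homogeneous : ∀ i c b, ∀ m ∈ (d i c b).support, m.degree + deg i c = deg (i + 1) b
  aug_homogeneous : ∀ c, aug (Pi.single c 1) ≠ 0 → deg 0 c = 0
  aug_surjective : Function.Surjective aug
  exact_zero : Function.Exact (d 0).mulVec aug
  exact_succ : ∀ i, Function.Exact (d (i + 1)).mulVec (d i).mulVec

attribute [instance] GradedFreeResolution.fintype GradedFreeResolution.decEq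

section Koszul

variable {K : Type*} [Field K] {n : ℕ}

/-- The matrix of the Koszul differential
`e_b ↦ ∑_{v ∈ b} (-1)^{#{t ∈ b | t < v}} x_v e_{b ∖ {v}}`. -/
def koszulMatrix (K : Type*) [Field K] (n i : ℕ) :
    Matrix {s : Finset (Fin n) // s.card = i} {s : Finset (Fin n) // s.card = i + 1}
      (MvPolynomial (Fin n) K) :=
  fun c b => ∑ v ∈ b.1, if b.1.erase v = c.1 then
    (-1) ^ (b.1.filter (· < v)).card * X v else 0

/-- Extension by zero of a family indexed by the subsets of size `i` to all subsets. -/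
def koszulExt {i : ℕ} (f : {s : Finset (Fin n) // s.card = i} → MvPolynomial (Fin n) K)
    (s : Finset (Fin n)) : MvPolynomial (Fin n) K :=
  if h : s.card = i then f ⟨s, h⟩ else 0

def koszulSign (R : Type*) [CommRing R] (u : Fin n) (c : Finset (Fin n)) : R :=
  (-1) ^ (c.filter (· < u)).card

theorem koszulMatrix_mulVec (i : ℕ)
    (f : {s : Finset (Fin n) // s.card = i + 1} → MvPolynomial (Fin n) K)
    (c : {s : Finset (Fin n) // s.card = i}) :
    (koszulMatrix K n i).mulVec f c =
      ∑ u : Fin n, if u ∈ c.1 then 0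
        else koszulSign _ u c.1 * X u * koszulExt f (insert u c.1) := by
  simp only [Matrix.mulVec, dotProduct, koszulMatrix, Finset.sum_mul]
  have h1 : ∀ b : {s : Finset (Fin n) // s.card = i + 1},
      (∑ v ∈ b.1, (if b.1.erase v = c.1 then
        (-1) ^ (b.1.filter (· < v)).card * X v else 0) * f b) =
      ∑ v : Fin n, if v ∈ b.1 ∧ b.1.erase v = c.1 then
        (-1) ^ (b.1.filter (· < v)).card * X v * f b else 0 := by
    intro b
    rw [← Finset.sum_filter_add_sum_filter_not Finset.univ (fun v => v ∈ b.1)]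
    rw [Finset.sum_eq_zero (s := Finset.univ.filter (fun v => v ∉ b.1))]
    · rw [add_zero]
      apply Finset.sum_congr
      · ext; simp
      · intro v hv
        have hv' : v ∈ b.1 := by simpa using hv
        simp [hv', ite_mul]
    · intro v hv
      have hv' : v ∉ b.1 := by simpa using hv
      simp [hv']
  rw [Finset.sum_congr rfl (fun b _ => h1 b), Finset.sum_comm]
  refine Finset.sum_congr rfl fun v _ => ?_
  by_cases hv : v ∈ c.1
  · rw [if_pos hv]
    refine Finset.sum_eq_zero fun b _ => if_neg ?_
    rintro ⟨_, h⟩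
    rw [← h] at hv
    simp at hv
  · have hcard : (insert v c.1).card = i + 1 := by
      rw [Finset.card_insert_of_notMem hv, c.2]
    rw [if_neg hv, Finset.sum_eq_single ⟨insert v c.1, hcard⟩]
    · have h2 : (insert v c.1).erase v = c.1 := Finset.erase_insert hv
      have h3 : (insert v c.1).filter (· < v) = c.1.filter (· < v) := by
        rw [Finset.filter_insert, if_neg (lt_irrefl v)]
      rw [if_pos ⟨Finset.mem_insert_self _ _, h2⟩]
      simp only [koszulSign, koszulExt, dif_pos hcard]
      rw [h3]
    · intro b _ hb
      refine if_neg ?_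
      rintro ⟨h, h'⟩
      apply hb
      apply Subtype.ext
      change b.1 = insert v c.1
      rw [← h', Finset.insert_erase h]
    · simp

theorem koszulSign_swap (R : Type*) [CommRing R] {u w : Fin n} {c : Finset (Fin n)}
    (hu : u ∉ c) (hw : w ∉ c) (huw : u ≠ w) :
    koszulSign R u c * koszulSign R w (insert u c) =
      -(koszulSign R w c * koszulSign R u (insert w c)) := by
  rcases lt_or_gt_of_ne huw with h | h
  · have h1 : (insert u c).filter (· < w) = insert u (c.filter (· < w)) := by
      rw [Finset.filter_insert, if_pos h]
    have h2 : (insert w c).filter (· < u) = c.filter (· < u) := by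
      rw [Finset.filter_insert, if_neg (not_lt.mpr h.le)]
    rw [koszulSign, koszulSign, koszulSign, koszulSign, h1, h2,
      Finset.card_insert_of_notMem (by simp [hu])]
    ring
  · have h1 : (insert w c).filter (· < u) = insert w (c.filter (· < u)) := by
      rw [Finset.filter_insert, if_pos h]
    have h2 : (insert u c).filter (· < w) = c.filter (· < w) := by
      rw [Finset.filter_insert, if_neg (not_lt.mpr h.le)]
    rw [koszulSign, koszulSign, koszulSign, koszulSign, h1, h2,
      Finset.card_insert_of_notMem (by simp [hw])]
    ring

theorem koszulExt_mulVec (i : ℕ)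
    (f : {s : Finset (Fin n) // s.card = i + 1} → MvPolynomial (Fin n) K) (c : Finset (Fin n)) :
    koszulExt ((koszulMatrix K n i).mulVec f) c =
      ∑ u : Fin n, if u ∈ c then 0 else koszulSign _ u c * X u * koszulExt f (insert u c) := by
  by_cases h : c.card = i
  · rw [koszulExt, dif_pos h, koszulMatrix_mulVec]
  · rw [koszulExt, dif_neg h]
    refine (Finset.sum_eq_zero fun u _ => ?_).symm
    split_ifs with hu
    · rfl
    · rw [koszulExt, dif_neg, mul_zero]
      rw [Finset.card_insert_of_notMem hu]
      omega

theorem koszulMatrix_comp (i : ℕ)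
    (f : {s : Finset (Fin n) // s.card = i + 1 + 1} → MvPolynomial (Fin n) K) :
    (koszulMatrix K n i).mulVec ((koszulMatrix K n (i + 1)).mulVec f) = 0 := by
  ext1 c
  rw [koszulMatrix_mulVec]
  simp only [koszulExt_mulVec, Pi.zero_apply]
  have h1 : ∀ u : Fin n, (if u ∈ c.1 then 0 else koszulSign (MvPolynomial (Fin n) K) u c.1 * X u *
      ∑ w : Fin n, if w ∈ insert u c.1 then 0 else
        koszulSign _ w (insert u c.1) * X w * koszulExt f (insert w (insert u c.1))) =
      ∑ w : Fin n, if u ∈ c.1 ∨ w ∈ insert u c.1 then 0 else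
        koszulSign _ u c.1 * koszulSign _ w (insert u c.1) * (X u * X w) *
          koszulExt f (insert w (insert u c.1)) := by
    intro u
    by_cases hu : u ∈ c.1
    · simp [hu]
    · simp only [hu, if_false, false_or, Finset.mul_sum]
      refine Finset.sum_congr rfl fun w _ => ?_
      split_ifs
      · simp
      · ring
  rw [Finset.sum_congr rfl (fun u _ => h1 u), ← Finset.sum_product']
  refine Finset.sum_involution (fun p _ => (p.2, p.1)) ?_ ?_ (by simp) (by simp)
  · rintro ⟨u, w⟩ _
    by_cases hu : u ∈ c.1
    · simp [hu]
    by_cases hw : w ∈ c.1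
    · simp [hw]
    by_cases huw : u = w
    · simp [huw]
    have h2 : ¬ (u ∈ c.1 ∨ w ∈ insert u c.1) := by simp [hu, hw, Ne.symm huw]
    have h3 : ¬ (w ∈ c.1 ∨ u ∈ insert w c.1) := by simp [hu, hw, huw]
    simp only [if_neg h2, if_neg h3]
    rw [koszulSign_swap _ hu hw huw, Finset.insert_comm]
    ring
  · rintro ⟨u, w⟩ _ h heq
    apply h
    have : w = u := by simpa using congrArg Prod.fst heq
    simp [this]

/-- The contracting homotopy of the Koszul complex. In multidegree `τ ≠ 0` it is the
cone construction at the least variable dividing `x^τ`. -/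
def koszulHomotopy (f : Finset (Fin n) → MvPolynomial (Fin n) K) (c : Finset (Fin n)) :
    MvPolynomial (Fin n) K :=
  ∑ v ∈ c.filter (fun v => ∀ t ∈ c, v ≤ t),
    ∑ m ∈ (f (c.erase v)).support.filter (fun m => m v ≠ 0 ∧ ∀ t, t < v → m t = 0),
      monomial (m - Finsupp.single v 1) (coeff m (f (c.erase v)))

theorem coeff_koszulHomotopy_of_least (f : Finset (Fin n) → MvPolynomial (Fin n) K)
    {c : Finset (Fin n)} {v : Fin n} (hv : v ∈ c) (hmin : ∀ t ∈ c, v ≤ t)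
    (m : Fin n →₀ ℕ) (hm : ∀ t, t < v → m t = 0) :
    coeff m (koszulHomotopy f c) = coeff (m + Finsupp.single v 1) (f (c.erase v)) := by
  have h1 : c.filter (fun v => ∀ t ∈ c, v ≤ t) = {v} := by
    ext w
    simp only [Finset.mem_filter, Finset.mem_singleton]
    constructor
    · rintro ⟨h, h'⟩
      exact le_antisymm (h' v hv) (hmin w h)
    · rintro rfl
      exact ⟨hv, hmin⟩
  rw [koszulHomotopy, h1, Finset.sum_singleton, coeff_sum]
  rw [Finset.sum_eq_single (m + Finsupp.single v 1)]
  · simp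
  · intro m' hm' hne
    rw [coeff_monomial, if_neg]
    rintro rfl
    apply hne
    have h0 : m' v ≠ 0 := (Finset.mem_filter.mp hm').2.1
    ext t
    by_cases ht : v = t
    · subst ht
      simp
      omega
    · simp [ht]
  · intro hm'
    by_contra hne
    apply hm'
    rw [Finset.mem_filter, mem_support_iff]
    refine ⟨fun h => hne ?_, by simp, fun t ht => ?_⟩
    · rw [h]
      simp
    · simp [hm t ht, ht.ne']

theorem coeff_koszulHomotopy_of_lt (f : Finset (Fin n) → MvPolynomial (Fin n) K)
    {c : Finset (Fin n)} {v : Fin n} (hlt : ∀ t ∈ c, v < t)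
    (m : Fin n →₀ ℕ) (hm : m v ≠ 0) :
    coeff m (koszulHomotopy f c) = 0 := by
  rw [koszulHomotopy, coeff_sum]
  refine Finset.sum_eq_zero fun w hw => ?_
  rw [coeff_sum]
  refine Finset.sum_eq_zero fun m' hm' => ?_
  rw [coeff_monomial, if_neg]
  rintro rfl
  apply hm
  have hvw : v < w := hlt w (Finset.mem_filter.mp hw).1
  simp [(Finset.mem_filter.mp hm').2.2 v hvw]

theorem coeff_koszulSign_mul (u : Fin n) (c : Finset (Fin n)) (p : MvPolynomial (Fin n) K)
    (m : Fin n →₀ ℕ) :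
    coeff m (koszulSign (MvPolynomial (Fin n) K) u c * X u * p) =
      koszulSign K u c * if m u = 0 then 0 else coeff (m - Finsupp.single u 1) p := by
  have h : koszulSign (MvPolynomial (Fin n) K) u c = C (koszulSign K u c) := by
    simp [koszulSign]
  rw [h, mul_assoc, coeff_C_mul, coeff_X_mul']
  by_cases hm : m u = 0 <;> simp [hm]

theorem koszulSign_of_lt {v : Fin n} {c : Finset (Fin n)} (h : ∀ t ∈ c, v ≤ t) :
    koszulSign K v c = 1 := by
  rw [koszulSign, Finset.filter_eq_empty_iff.mpr, Finset.card_empty, pow_zero]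
  intro t ht
  exact not_lt.mpr (h t ht)

theorem koszulHomotopy_spec (F : Finset (Fin n) → MvPolynomial (Fin n) K)
    (hF : ∀ c : Finset (Fin n), (∑ u : Fin n, if u ∈ c then 0
      else koszulSign (MvPolynomial (Fin n) K) u c * X u * F (insert u c)) = 0)
    (c : Finset (Fin n)) (m : Fin n →₀ ℕ) (hne : (m.support ∪ c).Nonempty) :
    coeff m (∑ u : Fin n, if u ∈ c then 0
      else koszulSign (MvPolynomial (Fin n) K) u c * X u * koszulHomotopy F (insert u c)) =
    coeff m (F c) := by
  obtain ⟨v, hv, hmin⟩ := Finset.exists_min_image _ id hne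
  simp only [id] at hmin
  have hm0 : ∀ t, t < v → m t = 0 := by
    intro t ht
    by_contra h
    exact absurd (hmin t (by simp [h])) (not_le.mpr ht)
  have hc0 : ∀ t ∈ c, v ≤ t := fun t ht => hmin t (by simp [ht])
  rw [coeff_sum]
  by_cases hvc : v ∈ c
  · have hcyc := congrArg (coeff (m + Finsupp.single v 1)) (hF (c.erase v))
    rw [coeff_sum, coeff_zero, ← Finset.add_sum_erase _ _ (Finset.mem_univ v)] at hcyc
    rw [if_neg (by simp), coeff_koszulSign_mul, Finset.insert_erase hvc,
      koszulSign_of_lt (fun t ht => hc0 t (Finset.mem_of_mem_erase ht)), if_neg (by simp),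
      one_mul, add_tsub_cancel_right] at hcyc
    rw [eq_neg_of_add_eq_zero_left hcyc, ← Finset.add_sum_erase _ _ (Finset.mem_univ v),
      if_pos hvc, coeff_zero, zero_add, ← Finset.sum_neg_distrib]
    refine Finset.sum_congr rfl fun u hu => ?_
    have huv : u ≠ v := Finset.ne_of_mem_erase hu
    by_cases huc : u ∈ c
    · simp [huc, huv]
    rw [if_neg huc, if_neg (by simp [huc]), coeff_koszulSign_mul, coeff_koszulSign_mul]
    have hmu : (m + Finsupp.single v 1 : Fin n →₀ ℕ) u = m u := by simp [huv]
    rw [hmu]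
    by_cases hu0 : m u = 0
    · simp [hu0]
    have hvu : v < u := lt_of_le_of_ne (hmin u (by simp [hu0])) huv.symm
    have hsg : koszulSign K u c = - koszulSign K u (c.erase v) := by
      have : c.filter (· < u) = insert v ((c.erase v).filter (· < u)) := by
        ext t
        by_cases htv : t = v
        · subst htv
          simp [hvc, hvu]
        · simp [htv]
      rw [koszulSign, koszulSign, this, Finset.card_insert_of_notMem (by simp)]
      ring
    rw [if_neg hu0, if_neg hu0, hsg,
      coeff_koszulHomotopy_of_least F (Finset.mem_insert_of_mem hvc)]
    · rw [Finset.erase_insert_of_ne huv]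
      have : m - Finsupp.single u 1 + Finsupp.single v 1 =
          m + Finsupp.single v 1 - Finsupp.single u 1 := by
        ext t
        by_cases ht : t = u
        · subst ht
          simp [huv]
        · simp [Finsupp.single_apply, Ne.symm ht]
      rw [this]
      ring
    · intro t ht
      rcases Finset.mem_insert.mp ht with rfl | ht
      · exact hvu.le
      · exact hc0 t ht
    · intro t ht
      simp [hm0 t ht]
  · have hmv : m v ≠ 0 := by
      rcases Finset.mem_union.mp hv with h | h
      · simpa using h
      · exact absurd h hvc
    rw [Finset.sum_eq_single v]
    · rw [if_neg hvc, coeff_koszulSign_mul, koszulSign_of_lt hc0, one_mul, if_neg hmv,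
        coeff_koszulHomotopy_of_least F (Finset.mem_insert_self _ _), Finset.erase_insert hvc]
      · congr 1
        ext t
        by_cases ht : v = t
        · subst ht
          simp
          omega
        · simp [ht]
      · intro t ht
        rcases Finset.mem_insert.mp ht with rfl | ht
        · exact le_rfl
        · exact hc0 t ht
      · intro t ht
        simp [hm0 t ht]
    · intro u _ huv
      by_cases huc : u ∈ c
      · simp [huc]
      rw [if_neg huc, coeff_koszulSign_mul]
      by_cases hu0 : m u = 0
      · simp [hu0]
      have hvu : v < u := lt_of_le_of_ne (hmin u (by simp [hu0])) huv.symm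
      rw [if_neg hu0, coeff_koszulHomotopy_of_lt (v := v), mul_zero]
      · intro t ht
        rcases Finset.mem_insert.mp ht with rfl | ht
        · exact hvu
        · exact lt_of_le_of_ne (hc0 t ht) (fun h => hvc (h ▸ ht))
      · simpa [huv] using hmv
    · simp

theorem koszul_lift (i : ℕ) (f : {s : Finset (Fin n) // s.card = i} → MvPolynomial (Fin n) K)
    (hF : ∀ c : Finset (Fin n), (∑ u : Fin n, if u ∈ c then 0 else
      koszulSign (MvPolynomial (Fin n) K) u c * X u * koszulExt f (insert u c)) = 0)
    (h0 : ∀ c : {s : Finset (Fin n) // s.card = i}, c.1 = ∅ → coeff 0 (f c) = 0) :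
    f ∈ Set.range (koszulMatrix K n i).mulVec := by
  refine ⟨fun b => koszulHomotopy (koszulExt f) b.1, ?_⟩
  ext c m
  have hext : koszulExt f c.1 = f c := by rw [koszulExt, dif_pos c.2]
  rw [koszulMatrix_mulVec]
  have h1 : (∑ u : Fin n, if u ∈ c.1 then 0 else
      koszulSign (MvPolynomial (Fin n) K) u c.1 * X u *
        koszulExt (fun b : {s : Finset (Fin n) // s.card = i + 1} =>
          koszulHomotopy (koszulExt f) b.1) (insert u c.1)) =
      ∑ u : Fin n, if u ∈ c.1 then 0 else
        koszulSign (MvPolynomial (Fin n) K) u c.1 * X u *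
          koszulHomotopy (koszulExt f) (insert u c.1) := by
    refine Finset.sum_congr rfl fun u _ => ?_
    by_cases hu : u ∈ c.1
    · simp [hu]
    · rw [if_neg hu, if_neg hu]
      congr 1
      rw [koszulExt, dif_pos (by rw [Finset.card_insert_of_notMem hu, c.2])]
  rw [h1]
  by_cases hne : (m.support ∪ c.1).Nonempty
  · rw [koszulHomotopy_spec _ hF _ _ hne, hext]
  · rw [Finset.not_nonempty_iff_eq_empty, Finset.union_eq_empty, Finsupp.support_eq_empty] at hne
    rw [hne.1, h0 c hne.2, coeff_sum]
    refine Finset.sum_eq_zero fun u _ => ?_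
    split_ifs
    · simp
    · rw [coeff_koszulSign_mul]
      simp

theorem koszul_exact_succ (i : ℕ) :
    Function.Exact (koszulMatrix K n (i + 1)).mulVec (koszulMatrix K n i).mulVec := by
  intro f
  constructor
  · intro hf
    refine koszul_lift (i + 1) f (fun c => ?_) fun c hc => ?_
    · rw [← koszulExt_mulVec, hf]
      simp [koszulExt]
    · have := c.2
      simp [hc] at this
  · rintro ⟨g, rfl⟩
    exact koszulMatrix_comp i g

/-- The augmentation `S → K = S / (x_1, …, x_n)`. -/
def koszulAug (K : Type*) [Field K] (n : ℕ) :
    ({s : Finset (Fin n) // s.card = 0} → MvPolynomial (Fin n) K)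
      →ₛₗ[(constantCoeff : MvPolynomial (Fin n) K →+* K)] K where
  toFun f := constantCoeff (f ⟨∅, rfl⟩)
  map_add' := by simp
  map_smul' := by simp

theorem koszul_exact_zero :
    Function.Exact (koszulMatrix K n 0).mulVec (koszulAug K n) := by
  intro f
  constructor
  · intro hf
    refine koszul_lift 0 f (fun c => ?_) fun c hc => ?_
    · refine Finset.sum_eq_zero fun u _ => ?_
      split_ifs
      · rfl
      · rw [koszulExt, dif_neg (by simp), mul_zero]
    · have : c = ⟨∅, rfl⟩ := Subtype.ext hc
      rw [this]
      exact hf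
  · rintro ⟨g, rfl⟩
    change constantCoeff ((koszulMatrix K n 0).mulVec g ⟨∅, rfl⟩) = 0
    rw [koszulMatrix_mulVec]
    simp

theorem koszulMatrix_homogeneous (i : ℕ) (c : {s : Finset (Fin n) // s.card = i})
    (b : {s : Finset (Fin n) // s.card = i + 1}) :
    ∀ m ∈ (koszulMatrix K n i c b).support, m.degree + i = i + 1 := by
  intro m hm
  have h : (koszulMatrix K n i c b).IsHomogeneous 1 := by
    refine IsHomogeneous.sum _ _ _ fun v _ => ?_
    split_ifs
    · have h1 : ((-1 : MvPolynomial (Fin n) K) ^ (b.1.filter (· < v)).card).IsHomogeneous 0 := by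
        have : (-1 : MvPolynomial (Fin n) K) ^ (b.1.filter (· < v)).card =
            C ((-1) ^ (b.1.filter (· < v)).card) := by simp
        rw [this]
        exact isHomogeneous_C _ _
      simpa using h1.mul (isHomogeneous_X K v)
    · exact isHomogeneous_zero _ _ _
  have h2 := h (mem_support_iff.mp hm)
  have h3 : m.degree = 1 := by rw [Finsupp.degree_eq_weight_one]; exact h2
  omega

/-- The Koszul complex of `x_1, …, x_n`, as a graded free resolution of `K`. -/
def koszulResolution (K : Type*) [Field K] (n : ℕ) : GradedFreeResolution K n where
  ι i := {s : Finset (Fin n) // s.card = i}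
  deg i _ := i
  d := koszulMatrix K n
  aug := koszulAug K n
  d_homogeneous := koszulMatrix_homogeneous
  aug_homogeneous _ _ := rfl
  aug_surjective a := ⟨fun _ => C a, by simp [koszulAug]⟩
  exact_zero := koszul_exact_zero
  exact_succ := koszul_exact_succ

end Koszul

section Tor

variable {K : Type*} [Field K] {n : ℕ} {M : Type*} [AddCommGroup M]
  [Module (MvPolynomial (Fin n) K) M] [Module K M] [IsScalarTower K (MvPolynomial (Fin n) K) M]

namespace GradedFreeResolution

/-- The differential of `F ⊗_S M`, from degree `i + 1` to degree `i`, where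
`F_i ⊗_S M = ⨁_{b ∈ ι i} M(-deg b)`. -/
def tensorD (F : GradedFreeResolution K n) (M : Type*) [AddCommGroup M]
    [Module (MvPolynomial (Fin n) K) M] [Module K M]
    [IsScalarTower K (MvPolynomial (Fin n) K) M] (i : ℕ) :
    (F.ι (i + 1) → M) →ₗ[K] (F.ι i → M) where
  toFun f c := ∑ b, F.d i c b • f b
  map_add' f g := by
    ext c
    simp [Finset.sum_add_distrib]
  map_smul' a f := by
    ext c
    simp only [Pi.smul_apply, RingHom.id_apply, Finset.smul_sum]
    refine Finset.sum_congr rfl fun b _ => ?_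
    rw [← algebraMap_smul (MvPolynomial (Fin n) K) a (f b),
      ← algebraMap_smul (MvPolynomial (Fin n) K) a (F.d i c b • f b), smul_comm]

/-- The component of internal degree `j` of `F_i ⊗_S M`, for a graded module `M = ⨁_j 𝓜 j`. -/
def tensorDegree (F : GradedFreeResolution K n) (𝓜 : ℤ → Submodule K M) (i : ℕ) (j : ℤ) :
    Submodule K (F.ι i → M) :=
  Submodule.pi Set.univ fun b => 𝓜 (j - F.deg i b)

/-- The cycles of `F ⊗_S M` in homological degree `i` and internal degree `j`. -/
def cycles (F : GradedFreeResolution K n) (𝓜 : ℤ → Submodule K M) : ∀ (i : ℕ) (_ : ℤ),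
    Submodule K (F.ι i → M)
  | 0, j => F.tensorDegree 𝓜 0 j
  | i + 1, j => F.tensorDegree 𝓜 (i + 1) j ⊓ LinearMap.ker (F.tensorD M i)

/-- The boundaries of `F ⊗_S M` in homological degree `i` and internal degree `j`. -/
def boundaries (F : GradedFreeResolution K n) (𝓜 : ℤ → Submodule K M) (i : ℕ) (j : ℤ) :
    Submodule K (F.ι i → M) :=
  (F.tensorDegree 𝓜 (i + 1) j).map (F.tensorD M i)

end GradedFreeResolution

/-- `Tor_i^S(M, K)_j` for a graded `S`-module `M = ⨁_j 𝓜 j`: the homology of `F ⊗_S M` in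
homological degree `i` and internal degree `j`, where `F` is the Koszul resolution of `K`. -/
abbrev gradedTor (n : ℕ) {M : Type*} [AddCommGroup M]
    [Module (MvPolynomial (Fin n) K) M] [Module K M] [IsScalarTower K (MvPolynomial (Fin n) K) M]
    (𝓜 : ℤ → Submodule K M) (i : ℕ) (j : ℤ) : Type _ :=
  (koszulResolution K n).cycles 𝓜 i j ⧸
    ((koszulResolution K n).boundaries 𝓜 i j).submoduleOf ((koszulResolution K n).cycles 𝓜 i j)

/-- The set of all `j - i` with `Tor_i^S(M, K)_j ≠ 0`. -/
def torShifts (n : ℕ) {M : Type*} [AddCommGroup M]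
    [Module (MvPolynomial (Fin n) K) M] [Module K M] [IsScalarTower K (MvPolynomial (Fin n) K) M]
    (𝓜 : ℤ → Submodule K M) : Set ℤ :=
  {r | ∃ (i : ℕ) (j : ℤ), Nontrivial (gradedTor n 𝓜 i j) ∧ r = j - i}

/-- The homogeneous elements of degree `j` of an ideal. -/
def idealDegree (I : Ideal (MvPolynomial (Fin n) K)) (j : ℤ) : Submodule K I where
  carrier := {f | ∀ m ∈ (f : MvPolynomial (Fin n) K).support, (m.degree : ℤ) = j}
  zero_mem' := by simp
  add_mem' {f g} hf hg m hm := by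
    classical
    rcases Finset.mem_union.mp (support_add hm) with h | h
    · exact hf m h
    · exact hg m h
  smul_mem' a f hf m hm := hf m (support_smul hm)

/-- The set of all `j - i` with `Tor_i^S(I, K)_j ≠ 0`, for a homogeneous ideal `I`. -/
def idealTorShifts (I : Ideal (MvPolynomial (Fin n) K)) : Set ℤ :=
  torShifts n (idealDegree I)

/-- The Castelnuovo-Mumford regularity `max {j - i : Tor_i^S(I, K)_j ≠ 0}` of a homogeneous ideal,
as a module. It has its meaning when this maximum exists. -/
def reg (I : Ideal (MvPolynomial (Fin n) K)) : ℤ :=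
  sSup (idealTorShifts I)

end Tor

section Monomial

variable {K : Type*} [Field K] {n : ℕ}

def IsMonomialIdeal (I : Ideal (MvPolynomial (Fin n) K)) : Prop :=
  ∃ A : Set (Fin n →₀ ℕ), I = Ideal.span ((fun a => monomial a (1 : K)) '' A)

/-- The variable `x` divides one of the minimal monomial generators of `I`. -/
def AppearsIn (x : Fin n) (I : Ideal (MvPolynomial (Fin n) K)) : Prop :=
  ∃ a : Fin n →₀ ℕ, Minimal (fun b => monomial b (1 : K) ∈ I) a ∧ a x ≠ 0

end Monomial

end

/-! By Hochster's formula (`nontrivial_gradedTor_iff`) the part of `Tor_i(I, K)` in multidegree `a`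
is the homology, at faces with `i` elements, of the upper Koszul complex `Δ_a(I)`, whose faces are
the squarefree `s ≤ a` with `x^(a - s) ∈ I`. Hence `reg I` is the largest `|a| - i` for which this
homology is nonzero.

The three ideals are compared through these complexes, with `e_x` the exponent of the variable `x`.
If `a_x = 0`, then `Δ_a(I, x) = Δ_a(I)`. If `a_x ≥ 1`, then `Δ_{a+e_x}(I) = Δ_a(I : x)`. In the
remaining case, `Δ_{a+e_x}(I)` with `a_x = 0`, the deletion of the vertex `x` is `Δ_a(I : x)` and
its link is `Δ_a(I) = Δ_a(I, x)`. With homology indexed by the number of elements of a face, the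
exact sequence `H_i(link) → H_i(deletion) → H_i(Δ) → H_{i-1}(link)` turns a class of `I` into one of
`I : x` with shift `|a| - i` lower by one, or one of `(I, x)` with the same shift. This is
`reg_le_max`.

For the dichotomy, `reg (I, x) ≤ reg I` (`reg_sup_span_X_le`): for `(I, x)` the complexes with `a_x
≥ 2` are cones, and for `a_x = 1`, `a ≠ e_x`, the deletion of `x` is a cone, so homology comes from
the link, a complex of `I`. If the inequality is strict, a class of `I : x` of shift `p` gives a
class of `I` of shift `p + 1`, or one of `(I, x)` of shift `p ≤ reg (I, x) < reg I`; either way `p +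
1 ≤ reg I` (`reg_colon_X_add_one_le`). -/

open MvPolynomial

/-! ### Simplicial chains, cones, and the exact sequence of a vertex -/

section SimplicialHomology

variable {K : Type*} [Field K] {n : ℕ}

/-- The simplicial boundary of a chain on the subsets of `Fin n`, read off coefficientwise. -/
def simplicialBoundary (f : Finset (Fin n) → K) (c : Finset (Fin n)) : K :=
  ∑ u : Fin n, if u ∈ c then 0 else koszulSign K u c * f (insert u c)

theorem simplicialBoundary_add (f g : Finset (Fin n) → K) :
    simplicialBoundary (f + g) = simplicialBoundary f + simplicialBoundary g := by
  ext c
  simp only [simplicialBoundary, Pi.add_apply, ← Finset.sum_add_distrib]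
  refine Finset.sum_congr rfl fun u _ => ?_
  split_ifs <;> ring

theorem simplicialBoundary_neg (f : Finset (Fin n) → K) :
    simplicialBoundary (-f) = -simplicialBoundary f := by
  ext c
  simp only [simplicialBoundary, Pi.neg_apply, ← Finset.sum_neg_distrib]
  refine Finset.sum_congr rfl fun u _ => ?_
  split_ifs <;> ring

theorem simplicialBoundary_zero : simplicialBoundary (0 : Finset (Fin n) → K) = 0 := by
  ext c
  simp [simplicialBoundary]

/-- The chain `f` is supported on the members of `P` of cardinality `i`. -/
def IsChainOn (P : Set (Finset (Fin n))) (i : ℕ) (f : Finset (Fin n) → K) : Prop :=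
  ∀ s, f s ≠ 0 → s ∈ P ∧ s.card = i

theorem IsChainOn.add {P : Set (Finset (Fin n))} {i : ℕ} {f g : Finset (Fin n) → K}
    (hf : IsChainOn P i f) (hg : IsChainOn P i g) : IsChainOn P i (f + g) := by
  intro s hs
  by_cases h : f s = 0
  · exact hg s fun h' => hs (by simp [h, h'])
  · exact hf s h

theorem IsChainOn.neg {P : Set (Finset (Fin n))} {i : ℕ} {f : Finset (Fin n) → K}
    (hf : IsChainOn P i f) : IsChainOn P i (-f) :=
  fun s hs => hf s (by simpa using hs)

theorem IsChainOn.mono {P Q : Set (Finset (Fin n))} {i : ℕ} {f : Finset (Fin n) → K}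
    (hf : IsChainOn P i f) (h : P ⊆ Q) : IsChainOn Q i f :=
  fun s hs => ⟨h (hf s hs).1, (hf s hs).2⟩

theorem isChainOn_zero (P : Set (Finset (Fin n))) (i : ℕ) :
    IsChainOn P i (0 : Finset (Fin n) → K) :=
  fun _ hs => absurd rfl hs

variable (K) in
/-- The homology of `P` with coefficients in `K` vanishes at the faces with `i` elements. -/
def HomologyVanishes (P : Set (Finset (Fin n))) (i : ℕ) : Prop :=
  ∀ f : Finset (Fin n) → K, IsChainOn P i f → simplicialBoundary f = 0 →
    ∃ g, IsChainOn P (i + 1) g ∧ simplicialBoundary g = f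

/-- The part of a chain that avoids the vertex `v`. -/
def deletionPart (v : Fin n) (f : Finset (Fin n) → K) (s : Finset (Fin n)) : K :=
  if v ∈ s then 0 else f s

/-- The part of a chain that contains the vertex `v`, as a chain on the link of `v`. -/
def linkPart (v : Fin n) (f : Finset (Fin n) → K) (s : Finset (Fin n)) : K :=
  if v ∈ s then 0 else koszulSign K v s * f (insert v s)

/-- The chain with deletion part `p` and link part `q`. -/
def joinParts (v : Fin n) (p q : Finset (Fin n) → K) (s : Finset (Fin n)) : K :=
  if v ∈ s then koszulSign K v (s.erase v) * q (s.erase v) else p s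

theorem deletionPart_zero (v : Fin n) : deletionPart v (0 : Finset (Fin n) → K) = 0 := by
  ext s
  simp [deletionPart]

theorem linkPart_zero (v : Fin n) : linkPart v (0 : Finset (Fin n) → K) = 0 := by
  ext s
  simp [linkPart]

theorem koszulSign_mul_self (v : Fin n) (c : Finset (Fin n)) :
    koszulSign K v c * koszulSign K v c = 1 := by
  rw [koszulSign, ← mul_pow]
  simp

/-- The summand `u = v` is the link part; the others never touch `v`. With `linkPart_boundary` this
says that the boundary acts on pairs (deletion, link) by `(p, q) ↦ (q + ∂p, -∂q)`, as in a mapping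
cone. -/
theorem deletionPart_boundary (v : Fin n) (f : Finset (Fin n) → K) :
    deletionPart v (simplicialBoundary f) =
      linkPart v f + simplicialBoundary (deletionPart v f) := by
  ext c
  simp only [deletionPart, linkPart, Pi.add_apply, simplicialBoundary]
  by_cases hv : v ∈ c
  · simp [hv]
  · simp only [hv, if_false]
    rw [← Finset.add_sum_erase _ _ (Finset.mem_univ v),
      ← Finset.add_sum_erase (a := v) Finset.univ (fun u => if u ∈ c then (0 : K) else
        koszulSign K u c * if v ∈ insert u c then 0 else f (insert u c)) (Finset.mem_univ v)]
    simp only [hv, if_false, Finset.mem_insert_self, if_true, mul_zero, zero_add]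
    congr 1
    refine Finset.sum_congr rfl fun u hu => ?_
    have : v ≠ u := (Finset.ne_of_mem_erase hu).symm
    simp [hv, this]

/-- The minus sign comes from interchanging the removals of `u` and `v`. -/
theorem linkPart_boundary (v : Fin n) (f : Finset (Fin n) → K) :
    linkPart v (simplicialBoundary f) = -simplicialBoundary (linkPart v f) := by
  ext c
  simp only [linkPart, Pi.neg_apply, simplicialBoundary]
  by_cases hv : v ∈ c
  · simp [hv]
  · simp only [hv, if_false, Finset.mul_sum, ← Finset.sum_neg_distrib]
    refine Finset.sum_congr rfl fun u _ => ?_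
    by_cases hu : u ∈ c
    · simp [hu]
    by_cases huv : u = v
    · simp [huv]
    have h1 : ¬ u ∈ insert v c := by simp [hu, huv]
    have h2 : ¬ v ∈ insert u c := by simp [hv, Ne.symm huv]
    simp only [hu, h1, h2, if_false]
    rw [← mul_assoc, koszulSign_swap K hv hu (Ne.symm huv), Finset.insert_comm]
    ring

theorem deletionPart_joinParts (v : Fin n) {p : Finset (Fin n) → K} (q : Finset (Fin n) → K)
    (hp : ∀ s, v ∈ s → p s = 0) : deletionPart v (joinParts v p q) = p := by
  ext s
  by_cases hv : v ∈ s <;> simp [deletionPart, joinParts, hv, hp]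

theorem linkPart_joinParts (v : Fin n) (p : Finset (Fin n) → K) {q : Finset (Fin n) → K}
    (hq : ∀ s, v ∈ s → q s = 0) : linkPart v (joinParts v p q) = q := by
  ext s
  by_cases hv : v ∈ s
  · simp [linkPart, hv, hq]
  · simp only [linkPart, joinParts, hv, if_false, Finset.mem_insert_self, if_true,
      Finset.erase_insert hv]
    rw [← mul_assoc, koszulSign_mul_self, one_mul]

theorem chain_ext (v : Fin n) {f g : Finset (Fin n) → K}
    (h : deletionPart v f = deletionPart v g) (h' : linkPart v f = linkPart v g) : f = g := by
  ext s
  by_cases hv : v ∈ s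
  · have h1 := congrFun h' (s.erase v)
    simp only [linkPart, Finset.notMem_erase, if_false, Finset.insert_erase hv] at h1
    have h2 : koszulSign K v (s.erase v) ≠ 0 :=
      left_ne_zero_of_mul (by rw [koszulSign_mul_self]; exact one_ne_zero)
    exact mul_left_cancel₀ h2 h1
  · simpa [deletionPart, hv] using congrFun h s

/-- A family of finite sets with a cone point has no homology. -/
theorem homologyVanishes_of_cone {P : Set (Finset (Fin n))} (v : Fin n)
    (h : ∀ s ∈ P, v ∉ s → insert v s ∈ P) (i : ℕ) : HomologyVanishes K P i := by
  intro f hf hc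
  have hq : ∀ s, v ∈ s → deletionPart v f s = 0 := fun s hs => by simp [deletionPart, hs]
  -- The filling is the cone with apex `v` over the part of `f` avoiding `v`; the cycle condition
  -- makes its link part correct.
  refine ⟨joinParts v 0 (deletionPart v f), fun s hs => ?_, chain_ext v ?_ ?_⟩
  · by_cases hv : v ∈ s
    · simp only [joinParts, hv, if_true, deletionPart, Finset.notMem_erase, if_false] at hs
      obtain ⟨h1, h2⟩ := hf _ (right_ne_zero_of_mul hs)
      have h3 := h _ h1 (Finset.notMem_erase v s)
      rw [Finset.insert_erase hv] at h3
      exact ⟨h3, by rw [← h2, Finset.card_erase_add_one hv]⟩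
    · simp [joinParts, hv] at hs
  · rw [deletionPart_boundary, linkPart_joinParts v _ hq,
      deletionPart_joinParts v (p := 0) _ (fun _ _ => rfl), simplicialBoundary_zero, add_zero]
  · rw [linkPart_boundary, linkPart_joinParts v _ hq]
    have h1 := deletionPart_boundary v f
    rw [hc, deletionPart_zero] at h1
    exact (eq_neg_of_add_eq_zero_left h1.symm).symm

/-- The faces of `P` that avoid `v`. -/
def faceDeletion (v : Fin n) (P : Set (Finset (Fin n))) : Set (Finset (Fin n)) :=
  {s | v ∉ s ∧ s ∈ P}

/-- The faces of the link of `v` in `P`. -/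
def faceLink (v : Fin n) (P : Set (Finset (Fin n))) : Set (Finset (Fin n)) :=
  {s | v ∉ s ∧ insert v s ∈ P}

theorem IsChainOn.deletionPart {P : Set (Finset (Fin n))} {i : ℕ} {f : Finset (Fin n) → K}
    (hf : IsChainOn P i f) (v : Fin n) : IsChainOn (faceDeletion v P) i (deletionPart v f) := by
  intro s hs
  by_cases hv : v ∈ s
  · simp [_root_.deletionPart, hv] at hs
  · simp only [_root_.deletionPart, hv, if_false] at hs
    exact ⟨⟨hv, (hf s hs).1⟩, (hf s hs).2⟩

theorem IsChainOn.linkPart {P : Set (Finset (Fin n))} {i k : ℕ} {f : Finset (Fin n) → K}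
    (hf : IsChainOn P i f) (hk : k + 1 = i) (v : Fin n) :
    IsChainOn (faceLink v P) k (linkPart v f) := by
  intro s hs
  by_cases hv : v ∈ s
  · simp [_root_.linkPart, hv] at hs
  · simp only [_root_.linkPart, hv, if_false] at hs
    obtain ⟨h1, h2⟩ := hf _ (right_ne_zero_of_mul hs)
    rw [Finset.card_insert_of_notMem hv] at h2
    exact ⟨⟨hv, h1⟩, by omega⟩

theorem IsChainOn.joinParts {P : Set (Finset (Fin n))} {i : ℕ} {v : Fin n}
    {p q : Finset (Fin n) → K} (hp : IsChainOn (faceDeletion v P) (i + 1) p)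
    (hq : IsChainOn (faceLink v P) i q) : IsChainOn P (i + 1) (joinParts v p q) := by
  intro s hs
  by_cases hv : v ∈ s
  · simp only [_root_.joinParts, hv, if_true] at hs
    obtain ⟨h1, h2⟩ := hq _ (right_ne_zero_of_mul hs)
    have h3 := h1.2
    rw [Finset.insert_erase hv] at h3
    exact ⟨h3, by rw [← h2, Finset.card_erase_add_one hv]⟩
  · simp only [_root_.joinParts, hv, if_false] at hs
    exact ⟨(hp s hs).1.2, (hp s hs).2⟩

theorem IsChainOn.eq_zero_of_mem {P : Set (Finset (Fin n))} {i : ℕ} {f : Finset (Fin n) → K}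
    (hf : IsChainOn P i f) {v : Fin n} (hP : ∀ s ∈ P, v ∉ s) (s : Finset (Fin n)) (hs : v ∈ s) :
    f s = 0 := by
  by_contra h
  exact hP s (hf s h).1 hs

/-- This inclusion induces the connecting map of the exact sequence, and is why `P` must be closed
under subsets. -/
theorem faceLink_subset_faceDeletion {P : Set (Finset (Fin n))} (hP : IsLowerSet P) (v : Fin n) :
    faceLink v P ⊆ faceDeletion v P :=
  fun s hs => ⟨hs.1, hP (Finset.subset_insert v s) hs.2⟩

/-- Exactness of `H(deletion) → H(P) → H(link)` in the long exact sequence of a vertex. -/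
theorem homologyVanishes_of_deletion_of_link {P : Set (Finset (Fin n))} (hP : IsLowerSet P)
    (v : Fin n) {i : ℕ} (hD : HomologyVanishes K (faceDeletion v P) i)
    (hL : ∀ k, k + 1 = i → HomologyVanishes K (faceLink v P) k) : HomologyVanishes K P i := by
  intro f hf hc
  have hl : simplicialBoundary (linkPart v f) = 0 := by
    have := linkPart_boundary v f
    rw [hc, linkPart_zero] at this
    exact neg_eq_zero.mp this.symm
  obtain ⟨q, hq, hqf⟩ : ∃ q, IsChainOn (faceLink v P) i q ∧
      simplicialBoundary q = linkPart v f := by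
    -- For `i = 0` only the empty face carries the chain, so the link part is zero and no hypothesis
    -- on the link is needed.
    rcases i with _ | k
    · refine ⟨0, isChainOn_zero _ _, ?_⟩
      rw [simplicialBoundary_zero]
      ext s
      by_contra h
      by_cases hv : v ∈ s
      · simp [linkPart, hv] at h
      · simp only [linkPart, hv, if_false] at h
        have := (hf _ (right_ne_zero_of_mul (Ne.symm h))).2
        rw [Finset.card_insert_of_notMem hv] at this
        omega
    · exact hL k rfl _ (hf.linkPart rfl v) hl
  have hr := deletionPart_boundary v f
  rw [hc, deletionPart_zero, ← hqf, ← simplicialBoundary_add] at hr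
  obtain ⟨p, hp, hpf⟩ := hD _
    ((hq.mono (faceLink_subset_faceDeletion hP v)).add (hf.deletionPart v)) hr.symm
  have hp0 := hp.eq_zero_of_mem (v := v) (fun s hs => hs.1)
  have hq0 := hq.neg.eq_zero_of_mem (v := v) (fun s hs => hs.1)
  -- The boundary of the pair `(p, -q)` is `(-q + ∂p, ∂q)`, and `∂p = q + deletionPart v f`.
  refine ⟨joinParts v p (-q), hp.joinParts hq.neg, chain_ext v ?_ ?_⟩
  · rw [deletionPart_boundary, linkPart_joinParts v _ hq0, deletionPart_joinParts v _ hp0, hpf]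
    simp
  · rw [linkPart_boundary, linkPart_joinParts v _ hq0, simplicialBoundary_neg, neg_neg, hqf]

/-- Exactness of `H(link) → H(deletion) → H(P)` in the long exact sequence of a vertex. -/
theorem homologyVanishes_faceDeletion {P : Set (Finset (Fin n))} (hP : IsLowerSet P)
    (v : Fin n) {i : ℕ} (h : HomologyVanishes K P i) (hL : HomologyVanishes K (faceLink v P) i) :
    HomologyVanishes K (faceDeletion v P) i := by
  intro f hf hc
  obtain ⟨g, hg, hgf⟩ := h f (hf.mono fun s hs => hs.2) hc
  have hr : deletionPart v f = f := by
    ext s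
    by_cases hv : v ∈ s
    · simp [deletionPart, hv, hf.eq_zero_of_mem (v := v) (fun s hs => hs.1) s hv]
    · simp [deletionPart, hv]
  have hlf : linkPart v f = 0 := by
    ext s
    simp [linkPart, hf.eq_zero_of_mem (v := v) (fun s hs => hs.1) (insert v s)]
  have h1 := linkPart_boundary v g
  rw [hgf, hlf] at h1
  obtain ⟨q, hq, hqg⟩ := hL _ (hg.linkPart rfl v) (neg_eq_zero.mp h1.symm)
  -- Since `∂q` is the link part of `g`, the boundary of this sum is the deletion part of `∂g = f`.
  refine ⟨q + deletionPart v g,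
    (hq.mono (faceLink_subset_faceDeletion hP v)).add (hg.deletionPart v), ?_⟩
  rw [simplicialBoundary_add, hqg, ← deletionPart_boundary, hgf, hr]

end SimplicialHomology

/-! ### Multigraded decomposition of Tor and Hochster's formula -/

section MultigradedTor

variable {K : Type*} [Field K] {n : ℕ}

/-- The exponent vector of the squarefree monomial with support `s`. -/
noncomputable def squarefreeExponent (s : Finset (Fin n)) : Fin n →₀ ℕ :=
  Finsupp.equivFunOnFinite.symm fun u => if u ∈ s then 1 else 0

theorem squarefreeExponent_apply (s : Finset (Fin n)) (u : Fin n) :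
    squarefreeExponent s u = if u ∈ s then 1 else 0 := rfl

theorem degree_squarefreeExponent (s : Finset (Fin n)) :
    (squarefreeExponent s).degree = s.card := by
  simp [Finsupp.degree_eq_sum, squarefreeExponent_apply]

theorem squarefreeExponent_insert {u : Fin n} {s : Finset (Fin n)} (hu : u ∉ s) :
    squarefreeExponent (insert u s) = Finsupp.single u 1 + squarefreeExponent s := by
  ext t
  by_cases h : t = u
  · subst h
    simp [squarefreeExponent_apply, hu]
  · simp [squarefreeExponent_apply, h]

/-- The upper Koszul simplicial complex of the ideal `I` at the exponent vector `a`. -/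
def upperKoszul (I : Ideal (MvPolynomial (Fin n) K)) (a : Fin n →₀ ℕ) : Set (Finset (Fin n)) :=
  {s | ∃ b, b + squarefreeExponent s = a ∧ monomial b (1 : K) ∈ I}

/-- The component of multidegree `a` of an element of the Koszul complex. -/
noncomputable def multidegreePart (a : Fin n →₀ ℕ) (F : Finset (Fin n) → MvPolynomial (Fin n) K)
    (s : Finset (Fin n)) : K :=
  if squarefreeExponent s ≤ a then coeff (a - squarefreeExponent s) (F s) else 0

/-- The Koszul differential on families indexed by all subsets. -/
noncomputable def koszulBoundary (F : Finset (Fin n) → MvPolynomial (Fin n) K) (c : Finset (Fin n)) :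
    MvPolynomial (Fin n) K :=
  ∑ u : Fin n, if u ∈ c then 0 else koszulSign _ u c * X u * F (insert u c)

/-- Removing `u` from a face while multiplying by `x_u` preserves the multidegree, so the Koszul
differential splits into simplicial boundaries. -/
theorem multidegreePart_koszulBoundary (a : Fin n →₀ ℕ)
    (F : Finset (Fin n) → MvPolynomial (Fin n) K) :
    multidegreePart a (koszulBoundary F) = simplicialBoundary (multidegreePart a F) := by
  ext c
  simp only [multidegreePart, koszulBoundary, simplicialBoundary]
  by_cases hc : squarefreeExponent c ≤ a
  · rw [if_pos hc, coeff_sum]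
    refine Finset.sum_congr rfl fun u _ => ?_
    by_cases hu : u ∈ c
    · simp [hu]
    · have h1 : (a - squarefreeExponent c) u = a u := by simp [squarefreeExponent_apply, hu]
      rw [if_neg hu, if_neg hu, coeff_koszulSign_mul, h1, squarefreeExponent_insert hu]
      by_cases h0 : a u = 0
      · rw [if_pos h0, if_neg]
        intro h
        have := h u
        simp [h0] at this
      · rw [if_neg h0, if_pos, tsub_tsub, add_comm]
        intro t
        by_cases ht : t = u
        · subst ht
          simp [squarefreeExponent_apply, hu]
          omega
        · simpa [Finsupp.single_apply, Ne.symm ht] using hc t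
  · rw [if_neg hc]
    refine (Finset.sum_eq_zero fun u _ => ?_).symm
    by_cases hu : u ∈ c
    · simp [hu]
    · rw [if_neg hu, if_neg, mul_zero]
      intro h
      rw [squarefreeExponent_insert hu] at h
      exact hc (le_trans le_add_self h)

theorem multidegreePart_zero (a : Fin n →₀ ℕ) :
    multidegreePart a (0 : Finset (Fin n) → MvPolynomial (Fin n) K) = 0 := by
  ext s
  simp [multidegreePart]

theorem ext_multidegreePart {F G : Finset (Fin n) → MvPolynomial (Fin n) K}
    (h : ∀ a, multidegreePart a F = multidegreePart a G) : F = G := by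
  ext s m
  simpa [multidegreePart] using congrFun (h (m + squarefreeExponent s)) s

/-- Every monomial occurring in an element of the ideal lies in the ideal. -/
def ContainsMonomials (I : Ideal (MvPolynomial (Fin n) K)) : Prop :=
  ∀ f ∈ I, ∀ m ∈ f.support, monomial m (1 : K) ∈ I

variable {I : Ideal (MvPolynomial (Fin n) K)} {i : ℕ} {j : ℤ}

/-- An element of the Koszul complex of `I` as a family indexed by all subsets. -/
noncomputable def idealKoszulExt (F : {s : Finset (Fin n) // s.card = i} → I) :
    Finset (Fin n) → MvPolynomial (Fin n) K :=
  koszulExt fun s => (F s : MvPolynomial (Fin n) K)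

theorem idealKoszulExt_injective {F G : {s : Finset (Fin n) // s.card = i} → I}
    (h : idealKoszulExt F = idealKoszulExt G) : F = G := by
  ext1 s
  have := congrFun h s.1
  simp only [idealKoszulExt, koszulExt, dif_pos s.2] at this
  exact Subtype.ext this

theorem idealKoszulExt_zero :
    idealKoszulExt (0 : {s : Finset (Fin n) // s.card = i} → I) = 0 := by
  ext1 c
  simp [idealKoszulExt, koszulExt]

theorem idealKoszulExt_tensorD (F : {s : Finset (Fin n) // s.card = i + 1} → I) :
    idealKoszulExt (i := i) ((koszulResolution K n).tensorD I i F) =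
      koszulBoundary (idealKoszulExt F) := by
  ext1 c
  refine Eq.trans ?_ (koszulExt_mulVec i _ c)
  refine congrFun (congrArg koszulExt ?_) c
  ext1 s
  simp only [GradedFreeResolution.tensorD, LinearMap.coe_mk, AddHom.coe_mk, Matrix.mulVec,
    dotProduct, AddSubmonoidClass.coe_finsetSum, Submodule.coe_smul, smul_eq_mul]
  rfl

theorem mem_tensorDegree_koszul {F : {s : Finset (Fin n) // s.card = i} → I} :
    F ∈ (koszulResolution K n).tensorDegree (idealDegree I) i j ↔
      ∀ s, ∀ m ∈ (F s : MvPolynomial (Fin n) K).support, (m.degree : ℤ) + i = j := by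
  refine forall_congr' fun s => (forall_prop_of_true (Set.mem_univ s)).trans
    (forall_congr' fun m => forall_congr' fun _ => ?_)
  change (m.degree : ℤ) = j - i ↔ _
  omega

theorem mem_cycles_koszul {F : {s : Finset (Fin n) // s.card = i} → I} :
    F ∈ (koszulResolution K n).cycles (idealDegree I) i j ↔
      F ∈ (koszulResolution K n).tensorDegree (idealDegree I) i j ∧
        koszulBoundary (idealKoszulExt F) = 0 := by
  -- In homological degree `0` the boundary condition is automatic: extension by zero kills every
  -- nonempty set.
  rcases i with _ | i
  · refine (and_iff_left ?_).symm
    ext1 c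
    refine Finset.sum_eq_zero fun u _ => ?_
    split_ifs
    · rfl
    · rw [idealKoszulExt, koszulExt, dif_neg (by simp), mul_zero]
  · refine and_congr_right fun _ => ?_
    rw [← idealKoszulExt_tensorD]
    change _ = _ ↔ _
    constructor
    · intro h
      rw [h]
      exact idealKoszulExt_zero
    · intro h
      exact idealKoszulExt_injective (h.trans idealKoszulExt_zero.symm)

/-- A nonzero coefficient puts its monomial in `I`, which is exactly the condition for a face of the
upper Koszul complex. -/
theorem isChainOn_multidegreePart (hI : ContainsMonomials I)
    (F : {s : Finset (Fin n) // s.card = i} → I) (a : Fin n →₀ ℕ) :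
    IsChainOn (upperKoszul I a) i (multidegreePart a (idealKoszulExt F)) := by
  intro s hs
  simp only [multidegreePart, idealKoszulExt, koszulExt] at hs
  split_ifs at hs with h1 h2
  · exact ⟨⟨_, tsub_add_cancel_of_le h1, hI _ (F ⟨s, h2⟩).2 _ (mem_support_iff.mpr hs)⟩, h2⟩
  · simp at hs
  · simp at hs

theorem multidegreePart_eq_zero_of_degree_ne {F : {s : Finset (Fin n) // s.card = i} → I}
    (hF : F ∈ (koszulResolution K n).tensorDegree (idealDegree I) i j) {a : Fin n →₀ ℕ}
    (ha : (a.degree : ℤ) ≠ j) : multidegreePart a (idealKoszulExt F) = 0 := by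
  ext s
  by_contra hs
  simp only [multidegreePart, idealKoszulExt, koszulExt] at hs
  split_ifs at hs with h1 h2
  · have h3 := mem_tensorDegree_koszul.mp hF ⟨s, h2⟩ _ (mem_support_iff.mpr hs)
    have h4 := congrArg Finsupp.degree (tsub_add_cancel_of_le h1)
    rw [map_add, degree_squarefreeExponent, h2] at h4
    omega
  · simp at hs
  · simp at hs

theorem finite_setOf_degree_eq (j : ℤ) : {a : Fin n →₀ ℕ | (a.degree : ℤ) = j}.Finite :=
  (Finsupp.finite_of_degree_eq j.toNat).subset fun a (ha : (a.degree : ℤ) = j) => by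
    change a.degree = _
    omega

/-- Chains on the upper Koszul complexes assemble to an element of the Koszul complex. -/
theorem exists_multidegreePart_eq {g : (Fin n →₀ ℕ) → Finset (Fin n) → K}
    (hg : ∀ a, IsChainOn (upperKoszul I a) i (g a)) (j : ℤ) :
    ∃ G : {s : Finset (Fin n) // s.card = i} → I,
      G ∈ (koszulResolution K n).tensorDegree (idealDegree I) i j ∧
        ∀ a, (a.degree : ℤ) = j → multidegreePart a (idealKoszulExt G) = g a := by
  have hle : ∀ a s, g a s ≠ 0 → squarefreeExponent s ≤ a := by
    intro a s h
    obtain ⟨⟨b, hb, _⟩, _⟩ := hg a s h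
    exact hb ▸ le_add_self
  have hmem : ∀ s : {s : Finset (Fin n) // s.card = i},
      ∑ a ∈ (finite_setOf_degree_eq j).toFinset,
        monomial (a - squarefreeExponent s.1) (g a s.1) ∈ I := by
    intro s
    refine Ideal.sum_mem _ fun a _ => ?_
    by_cases h : g a s.1 = 0
    · simp [h]
    · obtain ⟨⟨b, hb, hbI⟩, _⟩ := hg a s.1 h
      have h1 : a - squarefreeExponent s.1 = b := by rw [← hb, add_tsub_cancel_right]
      have h2 : monomial b (g a s.1) = C (g a s.1) * monomial b 1 := by simp [C_mul_monomial]
      rw [h1, h2]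
      exact I.mul_mem_left _ hbI
  refine ⟨fun s => ⟨_, hmem s⟩, mem_tensorDegree_koszul.mpr ?_, ?_⟩
  · intro s m hm
    classical
    obtain ⟨a, ha, hma⟩ := Finset.mem_biUnion.mp (support_sum hm)
    rw [mem_support_iff, coeff_monomial] at hma
    split_ifs at hma with h
    · have h4 := congrArg Finsupp.degree (tsub_add_cancel_of_le (hle a s.1 hma))
      rw [map_add, degree_squarefreeExponent, s.2, h] at h4
      have h5 : (a.degree : ℤ) = j := by simpa using ha
      omega
    · simp at hma
  · intro a ha
    ext s
    simp only [multidegreePart, idealKoszulExt, koszulExt]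
    by_cases h : g a s = 0
    · rw [h]
      split_ifs with h1 h2
      · rw [coeff_sum]
        refine Finset.sum_eq_zero fun a' _ => ?_
        rw [coeff_monomial]
        split_ifs with h3
        · by_contra h4
          -- Truncated subtraction of `s` is injective on exponents above `s`; nonvanishing of the
          -- coefficient `g a' s` gives `s ≤ a'`.
          have h5 := congrArg (· + squarefreeExponent s) h3
          simp only [tsub_add_cancel_of_le h1, tsub_add_cancel_of_le (hle a' s h4)] at h5
          exact h4 (h5 ▸ h)
        · rfl
      · simp
      · rfl
    · rw [if_pos (hle a s h), dif_pos (hg a s h).2, coeff_sum, Finset.sum_eq_single a]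
      · simp
      · intro a' _ hne
        rw [coeff_monomial]
        split_ifs with h3
        · by_contra h4
          have h5 := congrArg (· + squarefreeExponent s) h3
          simp only [tsub_add_cancel_of_le (hle a s h), tsub_add_cancel_of_le (hle a' s h4)] at h5
          exact hne h5
        · rfl
      · intro h'
        exact absurd ha (by simpa using h')

/-- The multigraded decomposition of `Tor`: Hochster's formula. -/
theorem nontrivial_gradedTor_iff (hI : ContainsMonomials I) (i : ℕ) (j : ℤ) :
    Nontrivial (gradedTor n (idealDegree I) i j) ↔
      ∃ a : Fin n →₀ ℕ, (a.degree : ℤ) = j ∧ ¬ HomologyVanishes K (upperKoszul I a) i := by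
  refine Submodule.Quotient.nontrivial_iff.trans ?_
  rw [Ne, Submodule.submoduleOf,
    Submodule.comap_subtype_eq_top, ← not_iff_not, not_not]
  push Not
  constructor
  · intro h a ha f hf hc
    -- The cycle `f` is placed in multidegree `a` and extended by zero to the other multidegrees.
    have hg : ∀ a', IsChainOn (upperKoszul I a') i (if a' = a then f else 0) := by
      intro a'
      split_ifs with h'
      · exact h' ▸ hf
      · exact isChainOn_zero _ _
    obtain ⟨F, hF, hFa⟩ := exists_multidegreePart_eq hg j
    have hcyc : koszulBoundary (idealKoszulExt F) = 0 := by
      refine ext_multidegreePart fun a' => ?_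
      rw [multidegreePart_koszulBoundary, multidegreePart_zero]
      by_cases hj : (a'.degree : ℤ) = j
      · rw [hFa a' hj]
        split_ifs
        · exact hc
        · exact simplicialBoundary_zero
      · rw [multidegreePart_eq_zero_of_degree_ne hF hj, simplicialBoundary_zero]
    obtain ⟨G, -, hG⟩ := h (mem_cycles_koszul.mpr ⟨hF, hcyc⟩)
    change {s : Finset (Fin n) // s.card = i + 1} → I at G
    refine ⟨multidegreePart a (idealKoszulExt G),
      isChainOn_multidegreePart hI _ a, ?_⟩
    have h1 := hFa a ha
    rw [if_pos rfl] at h1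
    rw [← multidegreePart_koszulBoundary, ← h1, ← idealKoszulExt_tensorD]
    exact congrArg (fun F => multidegreePart a (idealKoszulExt (i := i) F)) hG
  · intro h F hF
    obtain ⟨hF, hc⟩ := mem_cycles_koszul.mp hF
    -- The cycle is filled separately in each multidegree; outside total degree `j` its part is
    -- zero.
    have hex : ∀ a : Fin n →₀ ℕ, ∃ g, IsChainOn (upperKoszul I a) (i + 1) g ∧
        simplicialBoundary g = multidegreePart a (idealKoszulExt (i := i) F) := by
      intro a
      by_cases ha : (a.degree : ℤ) = j
      · refine h a ha _ (isChainOn_multidegreePart hI _ a) ?_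
        rw [← multidegreePart_koszulBoundary, hc, multidegreePart_zero]
      · refine ⟨0, isChainOn_zero _ _, ?_⟩
        rw [multidegreePart_eq_zero_of_degree_ne hF ha, simplicialBoundary_zero]
    choose g hg hgF using hex
    obtain ⟨G, hG, hGa⟩ := exists_multidegreePart_eq hg j
    refine ⟨G, hG, idealKoszulExt_injective (i := i) (ext_multidegreePart fun a => ?_)⟩
    rw [idealKoszulExt_tensorD, multidegreePart_koszulBoundary]
    by_cases ha : (a.degree : ℤ) = j
    · rw [hGa a ha, hgF]
    · rw [multidegreePart_eq_zero_of_degree_ne hG ha, simplicialBoundary_zero,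
        multidegreePart_eq_zero_of_degree_ne hF ha]

theorem mem_idealTorShifts_iff (hI : ContainsMonomials I) (r : ℤ) :
    r ∈ idealTorShifts I ↔ ∃ (i : ℕ) (a : Fin n →₀ ℕ),
      ¬ HomologyVanishes K (upperKoszul I a) i ∧ r = a.degree - i := by
  constructor
  · rintro ⟨i, j, h, rfl⟩
    obtain ⟨a, rfl, ha⟩ := (nontrivial_gradedTor_iff hI i j).mp h
    exact ⟨i, a, ha, rfl⟩
  · rintro ⟨i, a, ha, rfl⟩
    exact ⟨i, a.degree, (nontrivial_gradedTor_iff hI i _).mpr ⟨a, rfl, ha⟩, rfl⟩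

end MultigradedTor

/-! ### Upper Koszul complexes of `I : x` and `(I, x)` -/

section MonomialIdealRegularity

variable {K : Type*} [Field K] {n : ℕ} {I : Ideal (MvPolynomial (Fin n) K)}

theorem monomial_mem_of_le {a b : Fin n →₀ ℕ} (h : a ≤ b) (ha : monomial a (1 : K) ∈ I) :
    monomial b (1 : K) ∈ I := by
  have : monomial b (1 : K) = monomial (b - a) 1 * monomial a 1 := by
    rw [monomial_mul, tsub_add_cancel_of_le h, one_mul]
  rw [this]
  exact I.mul_mem_left _ ha

theorem IsMonomialIdeal.containsMonomials (hI : IsMonomialIdeal I) : ContainsMonomials I := by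
  obtain ⟨A, rfl⟩ := hI
  intro f hf m hm
  obtain ⟨a, ha, ham⟩ := mem_ideal_span_monomial_image.mp hf m hm
  exact monomial_mem_of_le ham (Ideal.subset_span ⟨a, ha, rfl⟩)

theorem monomial_mem_colon_iff (b : Fin n →₀ ℕ) (x : Fin n) :
    monomial b (1 : K) ∈ I.colon {X x} ↔ monomial (b + Finsupp.single x 1) (1 : K) ∈ I := by
  rw [Submodule.mem_colon_singleton, smul_eq_mul, X, monomial_mul, one_mul]

theorem ContainsMonomials.colon_X (hI : ContainsMonomials I) (x : Fin n) :
    ContainsMonomials (I.colon {X x}) := by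
  intro f hf m hm
  rw [Submodule.mem_colon_singleton, smul_eq_mul] at hf
  rw [monomial_mem_colon_iff]
  refine hI _ hf _ ?_
  rw [mem_support_iff, coeff_mul_X]
  exact mem_support_iff.mp hm

theorem ContainsMonomials.mem_or_of_mem_sup (hI : ContainsMonomials I) {x : Fin n}
    {f : MvPolynomial (Fin n) K} (hf : f ∈ I ⊔ Ideal.span {X x}) {m : Fin n →₀ ℕ}
    (hm : m ∈ f.support) : monomial m (1 : K) ∈ I ∨ m x ≠ 0 := by
  classical
  obtain ⟨g, hg, h, hh, rfl⟩ := Submodule.mem_sup.mp hf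
  rcases Finset.mem_union.mp (support_add hm) with h1 | h1
  · exact Or.inl (hI g hg m h1)
  · obtain ⟨q, rfl⟩ := Ideal.mem_span_singleton.mp hh
    right
    intro h0
    rw [mem_support_iff, coeff_X_mul', if_neg (by simpa using h0)] at h1
    exact h1 rfl

theorem monomial_mem_sup_of_ne_zero {x : Fin n} {m : Fin n →₀ ℕ} (h : m x ≠ 0) :
    monomial m (1 : K) ∈ I ⊔ Ideal.span {X x} := by
  refine monomial_mem_of_le (a := Finsupp.single x 1) ?_
    (Ideal.mem_sup_right (Ideal.mem_span_singleton_self _))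
  rw [Finsupp.single_le_iff]
  omega

theorem ContainsMonomials.sup_span_X (hI : ContainsMonomials I) (x : Fin n) :
    ContainsMonomials (I ⊔ Ideal.span {X x}) := by
  intro f hf m hm
  rcases hI.mem_or_of_mem_sup hf hm with h | h
  · exact Ideal.mem_sup_left h
  · exact monomial_mem_sup_of_ne_zero h

theorem ContainsMonomials.monomial_mem_sup_iff (hI : ContainsMonomials I) {x : Fin n}
    {m : Fin n →₀ ℕ} (hm : m x = 0) :
    monomial m (1 : K) ∈ I ⊔ Ideal.span {X x} ↔ monomial m (1 : K) ∈ I := by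
  refine ⟨fun h => ?_, fun h => Ideal.mem_sup_left h⟩
  exact (hI.mem_or_of_mem_sup h (by simp)).resolve_right (not_not.mpr hm)

theorem mem_upperKoszul_iff {a : Fin n →₀ ℕ} {s : Finset (Fin n)} :
    s ∈ upperKoszul I a ↔
      squarefreeExponent s ≤ a ∧ monomial (a - squarefreeExponent s) (1 : K) ∈ I := by
  constructor
  · rintro ⟨b, rfl, hb⟩
    exact ⟨le_add_self, by rwa [add_tsub_cancel_right]⟩
  · rintro ⟨h, hb⟩
    exact ⟨_, tsub_add_cancel_of_le h, hb⟩

theorem squarefreeExponent_mono {s t : Finset (Fin n)} (h : s ⊆ t) :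
    squarefreeExponent s ≤ squarefreeExponent t := by
  intro u
  simp only [squarefreeExponent_apply]
  split_ifs with h1 h2
  · exact le_rfl
  · exact absurd (h h1) h2
  · exact Nat.zero_le _
  · exact le_rfl

theorem isLowerSet_upperKoszul (a : Fin n →₀ ℕ) : IsLowerSet (upperKoszul I a) := by
  intro t s hst ht
  obtain ⟨h1, h2⟩ := mem_upperKoszul_iff.mp ht
  have h3 := squarefreeExponent_mono hst
  exact mem_upperKoszul_iff.mpr ⟨h3.trans h1, monomial_mem_of_le (tsub_le_tsub_left h3 a) h2⟩

theorem squarefreeExponent_insert_le {u : Fin n} {s : Finset (Fin n)} {a : Fin n →₀ ℕ}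
    (hs : squarefreeExponent s ≤ a) (hu : a u ≠ 0) : squarefreeExponent (insert u s) ≤ a := by
  intro t
  have := hs t
  simp only [squarefreeExponent_apply, Finset.mem_insert] at this ⊢
  by_cases ht : t = u
  · subst ht
    simp
    omega
  · simpa [ht] using this

theorem notMem_of_squarefreeExponent_le {u : Fin n} {s : Finset (Fin n)} {a : Fin n →₀ ℕ}
    (hs : squarefreeExponent s ≤ a) (hu : a u = 0) : u ∉ s := by
  intro h
  have := hs u
  simp [squarefreeExponent_apply, h, hu] at this

/-- Adding `x` to a face uses up the one extra factor `x`; as `a x = 0`, no face at `a` contains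
`x`. -/
theorem faceLink_upperKoszul {x : Fin n} {a : Fin n →₀ ℕ} (ha : a x = 0) :
    faceLink x (upperKoszul I (a + Finsupp.single x 1)) = upperKoszul I a := by
  ext s
  constructor
  · rintro ⟨hx, b, hb, hbI⟩
    rw [squarefreeExponent_insert hx, add_comm (Finsupp.single x 1), ← add_assoc] at hb
    exact ⟨b, add_right_cancel hb, hbI⟩
  · rintro ⟨b, rfl, hbI⟩
    have hx : x ∉ s := notMem_of_squarefreeExponent_le le_add_self ha
    exact ⟨hx, b, by rw [squarefreeExponent_insert hx, add_comm (Finsupp.single x 1), add_assoc],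
      hbI⟩

theorem mem_upperKoszul_colon_iff {x : Fin n} {a : Fin n →₀ ℕ} {s : Finset (Fin n)} :
    s ∈ upperKoszul (I.colon {X x}) a ↔
      squarefreeExponent s ≤ a ∧ s ∈ upperKoszul I (a + Finsupp.single x 1) := by
  rw [mem_upperKoszul_iff, mem_upperKoszul_iff, monomial_mem_colon_iff]
  refine and_congr_right fun h => ?_
  rw [tsub_add_eq_add_tsub h, and_iff_right (h.trans le_self_add)]

/-- A squarefree exponent uses `x` at most once, so once `a x ≥ 1` the extra factor admits no new
faces. -/
theorem upperKoszul_colon_of_ne_zero {x : Fin n} {a : Fin n →₀ ℕ} (ha : a x ≠ 0) :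
    upperKoszul (I.colon {X x}) a = upperKoszul I (a + Finsupp.single x 1) := by
  ext s
  rw [mem_upperKoszul_colon_iff, and_iff_right_iff_imp]
  intro hs u
  have h := (mem_upperKoszul_iff.mp hs).1 u
  by_cases hu : u = x
  · subst hu
    rw [squarefreeExponent_apply]
    split_ifs <;> omega
  · simpa [Finsupp.single_apply, Ne.symm hu] using h

/-- Here `s ≤ a` forbids `x`, while the extra factor allows it; the two complexes differ only in
faces containing `x`. -/
theorem upperKoszul_colon_of_eq_zero {x : Fin n} {a : Fin n →₀ ℕ} (ha : a x = 0) :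
    upperKoszul (I.colon {X x}) a =
      faceDeletion x (upperKoszul I (a + Finsupp.single x 1)) := by
  ext s
  rw [mem_upperKoszul_colon_iff]
  refine and_congr_left fun hs => ⟨fun h => notMem_of_squarefreeExponent_le h ha, fun hx u => ?_⟩
  have h := (mem_upperKoszul_iff.mp hs).1 u
  by_cases hu : u = x
  · subst hu
    simp [squarefreeExponent_apply, hx]
  · simpa [Finsupp.single_apply, Ne.symm hu] using h

theorem ContainsMonomials.upperKoszul_sup_of_eq_zero (hI : ContainsMonomials I) {x : Fin n}
    {a : Fin n →₀ ℕ} (ha : a x = 0) :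
    upperKoszul (I ⊔ Ideal.span {X x}) a = upperKoszul I a := by
  ext s
  rw [mem_upperKoszul_iff, mem_upperKoszul_iff, hI.monomial_mem_sup_iff (by simp [ha])]

/-- The vertex `x` is a cone point: after spending one factor `x`, another remains and keeps the
monomial in `(x)`. -/
theorem homologyVanishes_upperKoszul_sup {x : Fin n} {a : Fin n →₀ ℕ} (ha : 2 ≤ a x) (i : ℕ) :
    HomologyVanishes K (upperKoszul (I ⊔ Ideal.span {X x}) a) i := by
  refine homologyVanishes_of_cone x (fun s hs _ => ?_) i
  rw [mem_upperKoszul_iff] at hs ⊢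
  refine ⟨squarefreeExponent_insert_le hs.1 (by omega), monomial_mem_sup_of_ne_zero ?_⟩
  simp [squarefreeExponent_apply]
  omega

/-- A face avoiding `x` leaves the factor `x` in the monomial, so the deletion is the full simplex
on the support of `a`. For `a = 0` it would be `{∅}`, which has homology. -/
theorem homologyVanishes_faceDeletion_upperKoszul_sup {x : Fin n} {a : Fin n →₀ ℕ}
    (ha : a x = 0) (h0 : a ≠ 0) (i : ℕ) :
    HomologyVanishes K
      (faceDeletion x (upperKoszul (I ⊔ Ideal.span {X x}) (a + Finsupp.single x 1))) i := by
  obtain ⟨u, hu⟩ := Finsupp.ne_iff.mp h0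
  have hux : u ≠ x := by
    rintro rfl
    exact hu ha
  refine homologyVanishes_of_cone u ?_ i
  rintro s ⟨hx, hs⟩ _
  have hx' : x ∉ insert u s := by simp [hx, hux.symm]
  rw [mem_upperKoszul_iff] at hs
  refine ⟨hx', mem_upperKoszul_iff.mpr ⟨squarefreeExponent_insert_le hs.1 ?_,
    monomial_mem_sup_of_ne_zero ?_⟩⟩
  · rw [Finsupp.add_apply]
    exact fun h => hu (Nat.eq_zero_of_add_eq_zero_right h)
  · simp [squarefreeExponent_apply, hx', ha]

/-! ### Existence of the maxima -/

/-- The exponents of a variable beyond which the monomials of an ideal are stable. -/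
theorem exists_exponent_bound (I : Ideal (MvPolynomial (Fin n) K)) :
    ∃ N : ℕ, ∀ (b : Fin n →₀ ℕ) (t : Fin n), N ≤ b t →
      monomial (b + Finsupp.single t 1) (1 : K) ∈ I → monomial b (1 : K) ∈ I := by
  -- Dickson's lemma: the minimal exponents form an antichain in a well-quasi-order.
  have hfin : {a : Fin n →₀ ℕ | Minimal (fun b => monomial b (1 : K) ∈ I) a}.Finite :=
    (setOfPred_minimal_antichain _).finite_of_partiallyWellOrderedOn
      (Set.isPWO_of_wellQuasiOrderedLE _)
  refine ⟨hfin.toFinset.sup Finsupp.degree, fun b t hb hI => ?_⟩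
  obtain ⟨a, hab, ha⟩ := exists_minimal_le_of_wellFoundedLT
    (fun b : Fin n →₀ ℕ => monomial b (1 : K) ∈ I) _ hI
  refine monomial_mem_of_le (fun u => ?_) ha.prop
  by_cases hu : u = t
  · subst hu
    exact ((Finsupp.le_degree u a).trans
      (Finset.le_sup (f := Finsupp.degree) (hfin.mem_toFinset.mpr ha))).trans hb
  · simpa [Finsupp.single_apply, Ne.symm hu] using hab u

/-- If `a t` exceeds the stable exponent, spending a factor `x_t` does not affect membership, so `t`
is a cone point. Bounding `|a|` suffices, since subtracting `i` only lowers the shift. -/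
theorem exists_degree_bound (I : Ideal (MvPolynomial (Fin n) K)) :
    ∃ N : ℕ, ∀ (a : Fin n →₀ ℕ) (i : ℕ), ¬ HomologyVanishes K (upperKoszul I a) i →
      a.degree ≤ N := by
  obtain ⟨N, hN⟩ := exists_exponent_bound I
  refine ⟨n * N, fun a i h => ?_⟩
  have hle : ∀ t, a t ≤ N := by
    intro t
    by_contra! ht
    refine h (homologyVanishes_of_cone t (fun s hs hts => ?_) i)
    rw [mem_upperKoszul_iff] at hs ⊢
    refine ⟨squarefreeExponent_insert_le hs.1 (by omega), hN _ t ?_ ?_⟩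
    · simp [squarefreeExponent_apply]
      omega
    · suffices h1 : a - squarefreeExponent (insert t s) + Finsupp.single t 1 =
          a - squarefreeExponent s by
        rw [h1]
        exact hs.2
      ext u
      by_cases hu : u = t
      · subst hu
        simp [squarefreeExponent_apply, hts]
        omega
      · simp [squarefreeExponent_apply, hu]
  rw [Finsupp.degree_eq_sum]
  simpa using Finset.sum_le_card_nsmul Finset.univ (fun t => a t) N (fun t _ => hle t)

/-- A minimal generator contributes to `Tor_0`. -/
theorem not_homologyVanishes_of_minimal {a : Fin n →₀ ℕ}
    (ha : Minimal (fun b => monomial b (1 : K) ∈ I) a) :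
    ¬ HomologyVanishes K (upperKoszul I a) 0 := by
  have hchain : IsChainOn (upperKoszul I a) 0 (Pi.single ∅ (1 : K)) := by
    intro s hs
    have hs0 : s = ∅ := by
      by_contra h
      simp [h] at hs
    subst hs0
    refine ⟨⟨a, ?_, ha.prop⟩, rfl⟩
    ext u
    simp [squarefreeExponent_apply]
  intro h
  obtain ⟨g, hg, hgf⟩ := h _ hchain (by ext c; simp [simplicialBoundary])
  -- A one-element face would give a proper divisor of the minimal generator lying in `I`.
  have h0 : g = 0 := by
    ext s
    by_contra hs
    obtain ⟨⟨b, hb, hbI⟩, hc⟩ := hg s hs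
    have hba : b ≤ a := hb ▸ le_self_add
    have h1 := Finsupp.degree_mono (ha.le_of_le hbI hba)
    have h2 := congrArg Finsupp.degree hb
    rw [map_add, degree_squarefreeExponent] at h2
    omega
  rw [h0, simplicialBoundary_zero] at hgf
  simpa using congrFun hgf ∅

theorem isGreatest_reg (hI : ContainsMonomials I) {m : Fin n →₀ ℕ}
    (hm : monomial m (1 : K) ∈ I) : IsGreatest (idealTorShifts I) (reg I) := by
  obtain ⟨a, -, ha⟩ := exists_minimal_le_of_wellFoundedLT
    (fun b : Fin n →₀ ℕ => monomial b (1 : K) ∈ I) _ hm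
  have hne : (idealTorShifts I).Nonempty :=
    ⟨_, (mem_idealTorShifts_iff hI _).mpr ⟨0, a, not_homologyVanishes_of_minimal ha, rfl⟩⟩
  obtain ⟨N, hN⟩ := exists_degree_bound I
  have hb : BddAbove (idealTorShifts I) := by
    refine ⟨N, fun r hr => ?_⟩
    obtain ⟨i, a, h, rfl⟩ := (mem_idealTorShifts_iff hI r).mp hr
    have := hN a i h
    omega
  exact ⟨Int.csSup_mem hne hb, fun r hr => le_csSup hb hr⟩

/-! ### Comparison of the three regularities -/

theorem degree_sub_le_of_isGreatest (hI : ContainsMonomials I) {r : ℤ}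
    (hr : IsGreatest (idealTorShifts I) r) {a : Fin n →₀ ℕ} {i : ℕ}
    (h : ¬ HomologyVanishes K (upperKoszul I a) i) : (a.degree : ℤ) - i ≤ r :=
  hr.2 ((mem_idealTorShifts_iff hI _).mpr ⟨i, a, h, rfl⟩)

theorem exists_add_single_of_ne_zero {a : Fin n →₀ ℕ} {x : Fin n} (h : a x ≠ 0) :
    ∃ b : Fin n →₀ ℕ, a = b + Finsupp.single x 1 :=
  ⟨a - Finsupp.single x 1, (tsub_add_cancel_of_le (by rw [Finsupp.single_le_iff]; omega)).symm⟩

theorem reg_le_max (hI : ContainsMonomials I) {x : Fin n} {r p q : ℤ}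
    (hr : IsGreatest (idealTorShifts I) r) (hp : IsGreatest (idealTorShifts (I.colon {X x})) p)
    (hq : IsGreatest (idealTorShifts (I ⊔ Ideal.span {X x})) q) : r ≤ max (p + 1) q := by
  obtain ⟨i, a, h, rfl⟩ := (mem_idealTorShifts_iff hI r).mp hr.1
  rw [le_max_iff]
  by_cases hax : a x = 0
  · rw [← hI.upperKoszul_sup_of_eq_zero hax] at h
    exact Or.inr (degree_sub_le_of_isGreatest (hI.sup_span_X x) hq h)
  obtain ⟨b, rfl⟩ := exists_add_single_of_ne_zero hax
  simp only [map_add, Finsupp.degree_single, Nat.cast_add, Nat.cast_one]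
  by_cases hbx : b x = 0
  · by_cases h1 : HomologyVanishes K (upperKoszul (I.colon {X x}) b) i
    · rw [upperKoszul_colon_of_eq_zero hbx] at h1
      have h2 := mt (homologyVanishes_of_deletion_of_link (isLowerSet_upperKoszul _) x h1) h
      push Not at h2
      obtain ⟨k, rfl, hk⟩ := h2
      rw [faceLink_upperKoszul hbx, ← hI.upperKoszul_sup_of_eq_zero hbx] at hk
      -- Passing to the link lowers both the degree and the homological index by one, so the shift
      -- is unchanged.
      have := degree_sub_le_of_isGreatest (hI.sup_span_X x) hq hk
      right
      push_cast
      omega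
    · have := degree_sub_le_of_isGreatest (hI.colon_X x) hp h1
      omega
  · rw [← upperKoszul_colon_of_ne_zero hbx] at h
    have := degree_sub_le_of_isGreatest (hI.colon_X x) hp h
    omega

/-- The bound `1 ≤ r` absorbs the multidegree `e_x`, where the generator `x` may contribute a shift
of `1` not coming from `I`. -/
theorem reg_sup_span_X_le (hI : ContainsMonomials I) {x : Fin n} {r q : ℤ} (h1 : 1 ≤ r)
    (hr : IsGreatest (idealTorShifts I) r)
    (hq : IsGreatest (idealTorShifts (I ⊔ Ideal.span {X x})) q) : q ≤ r := by
  obtain ⟨i, a, h, rfl⟩ := (mem_idealTorShifts_iff (hI.sup_span_X x) q).mp hq.1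
  by_cases hax : a x = 0
  · rw [hI.upperKoszul_sup_of_eq_zero hax] at h
    exact degree_sub_le_of_isGreatest hI hr h
  obtain ⟨b, rfl⟩ := exists_add_single_of_ne_zero hax
  simp only [map_add, Finsupp.degree_single, Nat.cast_add, Nat.cast_one]
  by_cases hbx : b x = 0
  · by_cases hb : b = 0
    · subst hb
      simp only [map_zero]
      omega
    · have h2 := mt (homologyVanishes_of_deletion_of_link (isLowerSet_upperKoszul _) x
        (homologyVanishes_faceDeletion_upperKoszul_sup hbx hb i)) h
      push Not at h2
      obtain ⟨k, rfl, hk⟩ := h2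
      rw [faceLink_upperKoszul hbx, hI.upperKoszul_sup_of_eq_zero hbx] at hk
      have := degree_sub_le_of_isGreatest hI hr hk
      push_cast
      omega
  · refine absurd (homologyVanishes_upperKoszul_sup ?_ i) h
    simp
    omega

theorem reg_colon_X_add_one_le (hI : ContainsMonomials I) {x : Fin n} {r p q : ℤ}
    (hr : IsGreatest (idealTorShifts I) r) (hp : IsGreatest (idealTorShifts (I.colon {X x})) p)
    (hq : IsGreatest (idealTorShifts (I ⊔ Ideal.span {X x})) q) (hqr : q < r) : p + 1 ≤ r := by
  obtain ⟨i, a, h, rfl⟩ := (mem_idealTorShifts_iff (hI.colon_X x) p).mp hp.1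
  have key : ¬ HomologyVanishes K (upperKoszul I (a + Finsupp.single x 1)) i →
      (a.degree : ℤ) - i + 1 ≤ r := by
    intro h1
    have := degree_sub_le_of_isGreatest hI hr h1
    simp only [map_add, Finsupp.degree_single, Nat.cast_add, Nat.cast_one] at this
    omega
  by_cases hax : a x = 0
  · by_cases h1 : HomologyVanishes K (upperKoszul I (a + Finsupp.single x 1)) i
    · rw [upperKoszul_colon_of_eq_zero hax] at h
      -- A class of the deletion that dies in the whole complex comes from the link, hence from `(I,
      -- x)` in the same multidegree and index.
      have h2 := mt (homologyVanishes_faceDeletion (isLowerSet_upperKoszul _) x h1) h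
      rw [faceLink_upperKoszul hax, ← hI.upperKoszul_sup_of_eq_zero hax] at h2
      have := degree_sub_le_of_isGreatest (hI.sup_span_X x) hq h2
      omega
    · exact key h1
  · exact key (by rwa [← upperKoszul_colon_of_ne_zero hax])

end MonomialIdealRegularity

theorem mainTheorem8 {K : Type*} [Field K] {n : ℕ} (I : Ideal (MvPolynomial (Fin n) K))
    (hI : IsMonomialIdeal I) (x : Fin n) (hx : AppearsIn x I) :
    -- the three regularities are honest maxima
    (IsGreatest (idealTorShifts I) (reg I) ∧
      IsGreatest (idealTorShifts (I.colon {MvPolynomial.X x})) (reg (I.colon {MvPolynomial.X x})) ∧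
      IsGreatest (idealTorShifts (I ⊔ Ideal.span {MvPolynomial.X x}))
        (reg (I ⊔ Ideal.span {MvPolynomial.X x}))) ∧
    reg I ≤ max (reg (I.colon {MvPolynomial.X x}) + 1) (reg (I ⊔ Ideal.span {MvPolynomial.X x})) ∧
    (reg I = reg (I.colon {MvPolynomial.X x}) + 1 ∨
      reg I = reg (I ⊔ Ideal.span {MvPolynomial.X x})) := by
  obtain ⟨a, ha, hax⟩ := hx
  have hM := hI.containsMonomials
  have hr := isGreatest_reg hM ha.prop
  have hp := isGreatest_reg (hM.colon_X x)
    ((monomial_mem_colon_iff a x).mpr (monomial_mem_of_le le_self_add ha.prop))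
  have hq := isGreatest_reg (hM.sup_span_X x) (Ideal.mem_sup_left ha.prop)
  have hmax := reg_le_max hM hr hp hq
  -- A minimal generator divisible by `x` has positive degree and contributes to `Tor_0`.
  have h1 : 1 ≤ reg I := by
    have h2 := degree_sub_le_of_isGreatest hM hr (not_homologyVanishes_of_minimal ha)
    have h3 := Finsupp.le_degree x a
    omega
  have hqr := reg_sup_span_X_le hM h1 hr hq
  refine ⟨⟨hr, hp, hq⟩, hmax, ?_⟩
  rcases hqr.lt_or_eq with h | h
  · have h2 := reg_colon_X_add_one_le hM hr hp hq h
    rcases le_max_iff.mp hmax with h3 | h3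
    · exact Or.inl (le_antisymm h3 h2)
    · exact absurd h3 (not_le.mpr h)
  · exact Or.inr h.symm
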